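/- Let $k\ge 2$ and $r\ge 1$ be integers and let $\Gamma$ be a group. \emph{The category.} A symmetric $k$-ary forest $\sigma\circ p$ from $n$ to $m$ ($n,m\ge 1$) is a finite ordered rooted $k$-ary forest $p$ with $n$ roots and $m$ leaves together with a permutation $\sigma\in S_m$, drawn by joining the $i$-th leaf of $p$ to the $\sigma(i)$-th of $m$ endpoints; symmetric forests are composed by stacking diagrams, $f'\circ f$ being obtained by attaching the $j$-th root of $f'$ to the $j$-th endpoint of $f$. Let $\Theta$ be the monoidal functor from symmetric $k$-ary forests to groups given by $\Theta(n)=\Gamma^n$, $\Theta(Y_k)(g)=(g,e,\dots,e)\in\Gamma^k$ for the tree $Y_k$ with one root and $k$ leaves, and $\Theta(\sigma)(g_1,\dots,g_n)=(g_{\sigma^{-1}(1)},\dots,g_{\sigma^{-1}(n)})$ for $\sigma\in S_n$. Let $\mathcal C_k=\mathcal C(k,\mathrm{id},\Gamma)$ be the category with objects $1,2,3,\dots$ whose morphisms $n\to m$ are the pairs $g\circ f$ of a symmetric $k$-ary forest $f$ from $n$ to $m$ and an element $g\in\Gamma^m$, with composition $$(g'\circ f')\circ(g\circ f)=\bigl(g'\cdot\Theta(f')(g)\bigr)\circ(f'\circ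 f).$$ Let $\mathcal G_k$ be its universal groupoid, obtained by formally inverting all morphisms. \emph{The Higman--Thompson group.} Let $V_{k,r}$ be the group of all bijections of $[0,r)$ that are right-continuous and piecewise affine with finitely many breakpoints, all in $\mathbf Z[1/k]$, whose slopes are integer powers of $k$, and whose constant term on each piece lies in $\mathbf Z[1/k]$. It acts on the set $\mathbf Q_k(0,r)=\mathbf Z[1/k]\cap[0,r)$ of $k$-adic rationals in $[0,r)$. Let $\oplus_{\mathbf Q_k(0,r)}\Gamma$ be the group of finitely supported maps $\mathbf Q_k(0,r)\to\Gamma$, on which $V_{k,r}$ acts by $(v\cdot g)(d)=g(v^{-1}d)$. \emph{Proposition.} The automorphism group $\mathcal G_k(r,r)$ of the object $r$ of $\mathcal G_k$ is isomorphic to the wreath product $\oplus_{\mathbf Q_k(0,r)}\Gamma\rtimes V_{k,r}$ for this action. -/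

import Mathlib

open CategoryTheory

/-! ### `k`-ary forests -/

/-- Finite ordered rooted `k`-ary trees whose leaves carry labels in `X`. -/
inductive KTree (k : ℕ) (X : Type) : Type where
  | leaf : X → KTree k X
  | node : (Fin k → KTree k X) → KTree k X

namespace KTree

variable {k : ℕ} {X Y Z : Type}

/-- Graft the tree `F x` on every leaf labelled `x`. -/
def graft : KTree k X → (X → KTree k Y) → KTree k Y
  | leaf x, F => F x
  | node c, F => node fun i => (c i).graft F

/-- The number of leaves labelled `x`. -/
def count [DecidableEq X] (x : X) : KTree k X → ℕ
  | leaf y => if y = x then 1 else 0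
  | node c => ∑ i, (c i).count x

/-- Let a group element `g` sit at the root of a tree and push it up to the leaves, using the rule
`S_k(g) = (θ(g), e, …, e)` at every vertex. The result is the element that arrives at the leaf
labelled `x`: at a vertex the first child receives `θ(g)`, and the other children receive `e`. -/
def push [DecidableEq X] {Γ : Type*} [Group Γ] (θ : Γ →* Γ) (x : X) : KTree k X → Γ → Γ
  | leaf y, g => if y = x then g else 1
  | node c, g => if h : 0 < k then (c ⟨0, h⟩).push θ x (θ g) else 1

theorem graft_leaf (t : KTree k X) : t.graft leaf = t := by
  induction t with
  | leaf x => rfl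
  | node c ih => simp [graft, ih]

theorem graft_graft (t : KTree k X) (F : X → KTree k Y) (G : Y → KTree k Z) :
    (t.graft F).graft G = t.graft fun x => (F x).graft G := by
  induction t with
  | leaf x => rfl
  | node c ih => simp [graft, ih]

theorem count_graft [Fintype X] [DecidableEq X] [DecidableEq Y] (t : KTree k X)
    (F : X → KTree k Y) (y : Y) :
    (t.graft F).count y = ∑ x, t.count x * (F x).count y := by
  induction t with
  | leaf x => simp [graft, count]
  | node c ih =>
    simp only [graft, count, ih, Finset.sum_mul]
    exact Finset.sum_comm

section push

variable [DecidableEq X] [DecidableEq Y] {Γ : Type*} [Group Γ] (θ : Γ →* Γ)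

theorem push_mul (x : X) (t : KTree k X) (g h : Γ) :
    t.push θ x (g * h) = t.push θ x g * t.push θ x h := by
  induction t generalizing g h with
  | leaf y => by_cases hy : y = x <;> simp [push, hy]
  | node c ih => by_cases hk : 0 < k <;> simp [push, hk, ih]

theorem push_one (x : X) (t : KTree k X) : t.push θ x 1 = 1 := by
  induction t with
  | leaf y => simp [push]
  | node c ih => by_cases hk : 0 < k <;> simp [push, hk, ih]

theorem push_of_count_eq_zero (x : X) (t : KTree k X) (ht : t.count x = 0) (g : Γ) :
    t.push θ x g = 1 := by
  induction t generalizing g with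
  | leaf y =>
    by_cases hy : y = x
    · simp [count, hy] at ht
    · simp [push, hy]
  | node c ih =>
    by_cases hk : 0 < k
    · simp only [count, Finset.sum_eq_zero_iff, Finset.mem_univ, true_imp_iff] at ht
      simp [push, hk, ih _ (ht _)]
    · simp [push, hk]

theorem push_graft (t : KTree k X) (F : X → KTree k Y) (x : X) (y : Y)
    (hF : ∀ z, z ≠ x → (F z).count y = 0) (g : Γ) :
    (t.graft F).push θ y g = (F x).push θ y (t.push θ x g) := by
  induction t generalizing g with
  | leaf z =>
    by_cases hz : z = x
    · simp [graft, push, hz]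
    · simp [graft, push, hz, push_one, push_of_count_eq_zero θ y _ (hF z hz)]
  | node c ih => by_cases hk : 0 < k <;> simp [graft, push, hk, ih, push_one]

end push

end KTree

/-- A symmetric `k`-ary forest `σ ∘ p` with `n` roots and `m` leaves: an ordered forest `p` of `n`
trees, together with a bijection from its leaves onto the `m` endpoints (the diagram of `σ`). The
`i`-th leaf of `p` (from left to right) is labelled by `σ(i)`, so every `j` labels exactly one
leaf. -/
@[ext]
structure SymForest (k n m : ℕ) where
  tree : Fin n → KTree k (Fin m)
  count_eq : ∀ j, ∑ i, (tree i).count j = 1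

namespace SymForest

variable {k n m l : ℕ}

/-- The trivial forest with the trivial permutation. -/
def id (k n : ℕ) : SymForest k n n where
  tree := KTree.leaf
  count_eq j := by simp [KTree.count]

/-- `q ∘ p`: stack `q` on top of `p`, the `j`-th root of `q` being attached to the endpoint `j`
of `p`. -/
def comp (q : SymForest k m l) (p : SymForest k n m) : SymForest k n l where
  tree i := (p.tree i).graft q.tree
  count_eq j := by
    simp only [KTree.count_graft]
    rw [Finset.sum_comm]
    simp only [← Finset.sum_mul, p.count_eq, one_mul, q.count_eq]

theorem existsUnique_root (p : SymForest k n m) (j : Fin m) :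
    ∃! i, (p.tree i).count j ≠ 0 := by
  have h := p.count_eq j
  obtain ⟨i, -, hi⟩ : ∃ i ∈ Finset.univ, (p.tree i).count j ≠ 0 :=
    Finset.exists_ne_zero_of_sum_ne_zero (by rw [h]; exact one_ne_zero)
  refine ⟨i, hi, fun i' hi' => ?_⟩
  by_contra hne
  have h2 := Finset.add_le_sum (f := fun i => (p.tree i).count j) (s := Finset.univ)
    (fun _ _ => Nat.zero_le _) (Finset.mem_univ i) (Finset.mem_univ i') (Ne.symm hne)
  simp only [h] at h2
  omega

/-- The root of the tree that contains the leaf labelled `j`. -/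
noncomputable def root (p : SymForest k n m) (j : Fin m) : Fin n :=
  (p.existsUnique_root j).choose

theorem count_of_ne_root (p : SymForest k n m) {j : Fin m} {i : Fin n} (h : i ≠ p.root j) :
    (p.tree i).count j = 0 := by
  by_contra hc
  exact h ((p.existsUnique_root j).choose_spec.2 i hc)

theorem root_eq (p : SymForest k n m) {j : Fin m} {i : Fin n} (h : (p.tree i).count j ≠ 0) :
    p.root j = i :=
  ((p.existsUnique_root j).choose_spec.2 i h).symm

theorem root_id (j : Fin n) : (id k n).root j = j :=
  root_eq _ (by simp [id, KTree.count])

theorem root_comp (q : SymForest k m l) (p : SymForest k n m) (j : Fin l) :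
    (q.comp p).root j = p.root (q.root j) := by
  refine root_eq _ ?_
  have h1 := (p.existsUnique_root (q.root j)).choose_spec.1
  have h2 := (q.existsUnique_root j).choose_spec.1
  simp only [comp, KTree.count_graft, ne_eq, Finset.sum_eq_zero_iff, not_forall]
  exact ⟨q.root j, Finset.mem_univ _, mul_ne_zero h1 h2⟩

variable {Γ : Type*} [Group Γ] (θ : Γ →* Γ)

/-- The monoidal functor `Θ` on symmetric forests with `Θ(n) = Γⁿ`,
`Θ(Y_k)(g) = S_k(g) = (θ(g), e, …, e)` and `Θ(σ)(g) = (g_{σ⁻¹(1)}, …, g_{σ⁻¹(n)})`: the elements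
`g_1, …, g_n` at the roots are pushed up to the leaves and then sit at the endpoints. -/
noncomputable def Theta (p : SymForest k n m) : (Fin n → Γ) →* (Fin m → Γ) where
  toFun g j := (p.tree (p.root j)).push θ j (g (p.root j))
  map_one' := by funext j; simp [KTree.push_one]
  map_mul' g h := by funext j; simp [KTree.push_mul]

theorem Theta_id (g : Fin n → Γ) : (id k n).Theta θ g = g := by
  funext j
  simp only [Theta, MonoidHom.coe_mk, OneHom.coe_mk, root_id]
  simp [id, KTree.push]

theorem Theta_comp (q : SymForest k m l) (p : SymForest k n m) (g : Fin n → Γ) :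
    (q.comp p).Theta θ g = q.Theta θ (p.Theta θ g) := by
  funext j
  simp only [Theta, MonoidHom.coe_mk, OneHom.coe_mk, root_comp]
  exact KTree.push_graft θ _ _ _ _ (fun z hz => q.count_of_ne_root hz) _

end SymForest

/-! ### The category `C(k, θ, Γ)` and its universal groupoid -/

/-- The objects of the category `C(k, θ, Γ)`: the positive integers. -/
structure ForestCat (k : ℕ) {Γ : Type*} [Group Γ] (θ : Γ →* Γ) where
  rank : ℕ+

/-- A morphism `g ∘ (σ ∘ p)` of `C(k, θ, Γ)` from `n` to `m`: a symmetric forest `σ ∘ p` and an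
element `g` of `Γᵐ`. -/
@[ext]
structure ForestCat.Mor (k : ℕ) (Γ : Type*) (n m : ℕ) where
  forest : SymForest k n m
  label : Fin m → Γ

/-- The category `C(k, θ, Γ)`. Composition is determined by `f ∘ g = Θ(f)(g) ∘ f` for a symmetric
forest `f` and `g ∈ Γⁿ`, that is `(g' ∘ f') ∘ (g ∘ f) = (g' · Θ(f')(g)) ∘ (f' ∘ f)`.
In Mathlib's notation `u ≫ v` is `v ∘ u`. -/
noncomputable instance ForestCat.instCategory (k : ℕ) {Γ : Type*} [Group Γ] (θ : Γ →* Γ) :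
    Category (ForestCat k θ) where
  Hom a b := ForestCat.Mor k Γ a.rank b.rank
  id a := ⟨SymForest.id k a.rank, 1⟩
  comp u v := ⟨v.forest.comp u.forest, v.label * v.forest.Theta θ u.label⟩
  id_comp u := by
    apply ForestCat.Mor.ext
    · rfl
    · simp
  comp_id u := by
    apply ForestCat.Mor.ext
    · apply SymForest.ext
      funext i
      exact KTree.graft_leaf _
    · simp [SymForest.Theta_id]
  assoc u v w := by
    apply ForestCat.Mor.ext
    · apply SymForest.ext
      funext i
      exact KTree.graft_graft _ _ _
    · simp [SymForest.Theta_comp, mul_assoc]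

/-- The object `r` of the universal groupoid of `C(k, θ, Γ)`. -/
noncomputable abbrev universalGroupoidObj (k : ℕ) {Γ : Type*} [Group Γ] (θ : Γ →* Γ) (r : ℕ+) :
    FreeGroupoid (ForestCat k θ) :=
  FreeGroupoid.mk ⟨r⟩

/-! ### The Higman-Thompson groups -/

/-- `x` is a `k`-adic rational, that is `x ∈ ℤ[1/k]`. -/
def IsKadic (k : ℕ) (x : ℝ) : Prop :=
  ∃ (n : ℕ) (a : ℤ), (k : ℝ) ^ n * x = a

namespace IsKadic

variable {k : ℕ} {x y : ℝ}

theorem add (hx : IsKadic k x) (hy : IsKadic k y) : IsKadic k (x + y) := by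
  obtain ⟨n, a, ha⟩ := hx
  obtain ⟨m, b, hb⟩ := hy
  refine ⟨n + m, k ^ m * a + k ^ n * b, ?_⟩
  push_cast
  rw [← ha, ← hb]
  ring

theorem neg (hx : IsKadic k x) : IsKadic k (-x) := by
  obtain ⟨n, a, ha⟩ := hx
  exact ⟨n, -a, by push_cast; rw [← ha]; ring⟩

theorem zpow_mul (hx : IsKadic k x) (j : ℤ) : IsKadic k ((k : ℝ) ^ j * x) := by
  obtain ⟨n, a, ha⟩ := hx
  rcases Nat.eq_zero_or_pos k with rfl | hk
  · exact ⟨1, 0, by simp⟩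
  have hk' : (k : ℝ) ≠ 0 := by positivity
  obtain ⟨p, rfl | rfl⟩ := j.eq_nat_or_neg
  · refine ⟨n, k ^ p * a, ?_⟩
    push_cast
    rw [← ha, zpow_natCast]
    ring
  · refine ⟨n + p, a, ?_⟩
    rw [← ha, zpow_neg, zpow_natCast]
    field_simp
    ring

end IsKadic

/-- On the nonempty interval `[c, d) ⊆ [0, r)` with `k`-adic endpoints, `f` is affine: its slope is
a power of `k` and its constant term is `k`-adic. -/
def IsKadicAffineOn (k r : ℕ) (f : Set.Ico (0 : ℝ) r → Set.Ico (0 : ℝ) r) (c d : ℝ) : Prop :=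
  (0 ≤ c ∧ c < d ∧ d ≤ r ∧ IsKadic k c ∧ IsKadic k d) ∧
    ∃ (j : ℤ) (b : ℝ), IsKadic k b ∧
      ∀ x : Set.Ico (0 : ℝ) r, c ≤ x → (x : ℝ) < d → (f x : ℝ) = (k : ℝ) ^ j * x + b

/-- `f` is piecewise affine in the above sense: `[0, r)` is covered by finitely many such
intervals. -/
def IsKadicPL (k r : ℕ) (f : Set.Ico (0 : ℝ) r → Set.Ico (0 : ℝ) r) : Prop :=
  ∃ P : Set (ℝ × ℝ), P.Finite ∧ (∀ p ∈ P, IsKadicAffineOn k r f p.1 p.2) ∧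
    ∀ x : Set.Ico (0 : ℝ) r, ∃ p ∈ P, p.1 ≤ x ∧ (x : ℝ) < p.2

theorem IsKadicPL.one (k r : ℕ) : IsKadicPL k r fun x => x := by
  refine ⟨{p | p = (0, (r : ℝ)) ∧ 0 < r}, (Set.finite_singleton (0, (r : ℝ))).subset fun p hp => hp.1,
    ?_, fun x => ⟨(0, r), ⟨rfl, ?_⟩, x.2.1, x.2.2⟩⟩
  · rintro p ⟨rfl, hr⟩
    exact ⟨⟨le_rfl, Nat.cast_pos.2 hr, le_rfl, ⟨0, 0, by simp⟩, ⟨0, r, by simp⟩⟩,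
      0, 0, ⟨0, 0, by simp⟩, fun x _ _ => by simp⟩
  · exact_mod_cast x.2.1.trans_lt x.2.2

theorem IsKadicAffineOn.slope_pos {k r : ℕ} {f : Equiv.Perm (Set.Ico (0 : ℝ) r)} {c d : ℝ} {j : ℤ}
    {b : ℝ} (h0 : 0 ≤ c) (hcd : c < d) (hd : d ≤ r)
    (h : ∀ x : Set.Ico (0 : ℝ) r, c ≤ x → (x : ℝ) < d → (f x : ℝ) = (k : ℝ) ^ j * x + b) :
    0 < (k : ℝ) ^ j := by
  refine lt_of_le_of_ne (by positivity) fun hk => ?_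
  have h1 := h ⟨c, h0, by linarith⟩ le_rfl hcd
  have h2 := h ⟨(c + d) / 2, by linarith, by linarith⟩ (by simp only; linarith)
    (by simp only; linarith)
  rw [← hk, zero_mul] at h1 h2
  have h3 := f.injective (Subtype.ext (h1.trans h2.symm))
  have h4 : c = (c + d) / 2 := congrArg Subtype.val h3
  linarith

theorem IsKadicPL.comp {k r : ℕ} {f g : Equiv.Perm (Set.Ico (0 : ℝ) r)}
    (hf : IsKadicPL k r f) (hg : IsKadicPL k r g) : IsKadicPL k r (f ∘ g) := by
  obtain ⟨P, hPf, hP, hPc⟩ := hf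
  obtain ⟨Q, hQf, hQ, hQc⟩ := hg
  choose! i₁ j b hb hj using hP
  choose! i₂ l a ha hl using hQ
  let z : ℝ × ℝ → ℝ × ℝ → ℝ × ℝ := fun q p =>
    (max q.1 ((k : ℝ) ^ (-l q) * (p.1 + -a q)), min q.2 ((k : ℝ) ^ (-l q) * (p.2 + -a q)))
  have key : ∀ q ∈ Q, ∀ p x : ℝ, (p ≤ (k : ℝ) ^ l q * x + a q ↔
      (k : ℝ) ^ (-l q) * (p + -a q) ≤ x) := by
    intro q hq p x
    have hpos := IsKadicAffineOn.slope_pos (i₂ q hq).1 (i₂ q hq).2.1 (i₂ q hq).2.2.1 (hl q hq)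
    rw [zpow_neg, inv_mul_le_iff₀ hpos]
    constructor <;> intro h <;> linarith
  refine ⟨{w | w.1 < w.2 ∧ w ∈ Set.image2 z Q P}, (hQf.image2 z hPf).subset fun w hw => hw.2, ?_, ?_⟩
  · rintro _ ⟨hlt, q, hq, p, hp, rfl⟩
    refine ⟨⟨(i₂ q hq).1.trans (le_max_left _ _), hlt,
      (min_le_left _ _).trans (i₂ q hq).2.2.1, ?_, ?_⟩, j p + l q, (k : ℝ) ^ j p * a q + b p,
      ((ha q hq).zpow_mul _).add (hb p hp), ?_⟩
    · rcases max_choice q.1 ((k : ℝ) ^ (-l q) * (p.1 + -a q)) with h | h <;> simp only [z, h]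
      · exact (i₂ q hq).2.2.2.1
      · exact ((i₁ p hp).2.2.2.1.add (ha q hq).neg).zpow_mul _
    · rcases min_choice q.2 ((k : ℝ) ^ (-l q) * (p.2 + -a q)) with h | h <;> simp only [z, h]
      · exact (i₂ q hq).2.2.2.2
      · exact ((i₁ p hp).2.2.2.2.add (ha q hq).neg).zpow_mul _
    · intro x hx1 hx2
      simp only [z, max_le_iff, lt_min_iff] at hx1 hx2
      have hgx := hl q hq x hx1.1 hx2.1
      have hk : (k : ℝ) ≠ 0 ∨ l q = 0 := by
        have := (IsKadicAffineOn.slope_pos (i₂ q hq).1 (i₂ q hq).2.1 (i₂ q hq).2.2.1 (hl q hq)).ne'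
        by_contra! hc
        rw [hc.1, zero_zpow _ hc.2] at this
        exact this rfl
      have hpow : (k : ℝ) ^ (j p + l q) = (k : ℝ) ^ j p * (k : ℝ) ^ l q := by
        rcases hk with hk | hk
        · exact zpow_add₀ hk _ _
        · simp [hk]
      rw [Function.comp_apply, hj p hp (g x) (by rw [hgx, key q hq]; exact hx1.2)
        (by rw [hgx, ← not_le, key q hq, not_le]; exact hx2.2), hgx, hpow]
      ring
  · intro x
    obtain ⟨q, hq, hq1, hq2⟩ := hQc x
    obtain ⟨p, hp, hp1, hp2⟩ := hPc (g x)
    rw [hl q hq x hq1 hq2] at hp1 hp2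
    rw [key q hq] at hp1
    rw [← not_le, key q hq, not_le] at hp2
    have h1 : (z q p).1 ≤ x := max_le hq1 hp1
    have h2 : (x : ℝ) < (z q p).2 := lt_min hq2 hp2
    exact ⟨z q p, ⟨h1.trans_lt h2, q, hq, p, hp, rfl⟩, h1, h2⟩

theorem IsKadicPL.symm {k r : ℕ} {f : Equiv.Perm (Set.Ico (0 : ℝ) r)}
    (hf : IsKadicPL k r f) : IsKadicPL k r f.symm := by
  obtain ⟨P, hPf, hP, hPc⟩ := hf
  choose! i j b hb hj using hP
  have pos : ∀ p ∈ P, 0 < (k : ℝ) ^ j p := fun p hp =>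
    IsKadicAffineOn.slope_pos (i p hp).1 (i p hp).2.1 (i p hp).2.2.1 (hj p hp)
  let z : ℝ × ℝ → ℝ × ℝ := fun p => ((k : ℝ) ^ j p * p.1 + b p, (k : ℝ) ^ j p * p.2 + b p)
  refine ⟨z '' P, hPf.image z, ?_, ?_⟩
  · rintro _ ⟨p, hp, rfl⟩
    have hk := pos p hp
    obtain ⟨h0, hlt, hr, hc, hd⟩ := i p hp
    have e1 := hj p hp ⟨p.1, h0, by linarith⟩ le_rfl hlt
    refine ⟨⟨?_, ?_, ?_, (hc.zpow_mul _).add (hb p hp), (hd.zpow_mul _).add (hb p hp)⟩, -j p,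
      (k : ℝ) ^ (-j p) * (-b p), (hb p hp).neg.zpow_mul _, ?_⟩
    · exact (f _).2.1.trans_eq e1
    · simp only [z]
      nlinarith
    · by_contra! hc'
      simp only [z] at hc'
      have hx : ((r : ℝ) - b p) / (k : ℝ) ^ j p < p.2 := by rw [div_lt_iff₀ hk]; linarith
      obtain ⟨x, hx1, hx2⟩ := exists_between (max_lt hx hlt)
      rw [max_lt_iff] at hx1
      have e2 := hj p hp ⟨x, by linarith, by linarith⟩ hx1.2.le hx2
      have e3 := (f ⟨x, by linarith, by linarith⟩).2.2
      rw [e2] at e3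
      have := hx1.1
      rw [div_lt_iff₀ hk] at this
      simp only at e3
      linarith
    · intro y hy1 hy2
      simp only [z] at hy1 hy2
      have g1 : p.1 ≤ (k : ℝ) ^ (-j p) * (y + -b p) := by
        rw [zpow_neg, le_inv_mul_iff₀ hk]; linarith
      have g2 : (k : ℝ) ^ (-j p) * (y + -b p) < p.2 := by
        rw [zpow_neg, inv_mul_lt_iff₀ hk]; linarith
      have e2 := hj p hp ⟨_, h0.trans g1, g2.trans_le hr⟩ g1 g2
      have e3 : f ⟨_, h0.trans g1, g2.trans_le hr⟩ = y := by
        apply Subtype.ext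
        refine e2.trans ?_
        change (k : ℝ) ^ j p * ((k : ℝ) ^ (-j p) * (y + -b p)) + b p = y
        rw [zpow_neg]
        field_simp
        ring
      rw [← e3, Equiv.symm_apply_apply, e3]
      ring
  · intro y
    obtain ⟨p, hp, h1, h2⟩ := hPc (f.symm y)
    have e := hj p hp _ h1 h2
    rw [Equiv.apply_symm_apply] at e
    have hk := pos p hp
    refine ⟨z p, ⟨p, hp, rfl⟩, ?_, ?_⟩ <;> simp only [z, e]
    · nlinarith
    · nlinarith

/-- The Higman-Thompson group `V_{k,r}`: the piecewise affine bijections of `[0, r)`, right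
continuous with finitely many breakpoints, all of them `k`-adic, whose slopes are powers of `k` and
which preserve the `k`-adic rationals. -/
def HigmanThompson (k r : ℕ) : Subgroup (Equiv.Perm (Set.Ico (0 : ℝ) r)) where
  carrier := {f | IsKadicPL k r f}
  mul_mem' hf hg := hf.comp hg
  one_mem' := IsKadicPL.one k r
  inv_mem' hf := hf.symm

/-- `Q_k(0, r)`: the `k`-adic rationals in `[0, r)`. -/
abbrev KadicIco (k r : ℕ) : Type :=
  {x : Set.Ico (0 : ℝ) r // IsKadic k x}

theorem IsKadicPL.map_isKadic {k r : ℕ} {f : Set.Ico (0 : ℝ) r → Set.Ico (0 : ℝ) r}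
    (hf : IsKadicPL k r f) {x : Set.Ico (0 : ℝ) r} (hx : IsKadic k x) : IsKadic k (f x) := by
  obtain ⟨P, -, hP, hcov⟩ := hf
  obtain ⟨p, hp, h1, h2⟩ := hcov x
  obtain ⟨-, j, b, hb, h⟩ := hP p hp
  rw [h x h1 h2]
  exact (hx.zpow_mul j).add hb

/-- The classical action of `V_{k,r}` on `Q_k(0, r)`. -/
instance HigmanThompson.instMulAction (k r : ℕ) :
    MulAction (HigmanThompson k r) (KadicIco k r) where
  smul v x := ⟨v.1 x.1, IsKadicPL.map_isKadic v.2 x.2⟩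
  one_smul _ := rfl
  mul_smul _ _ _ := rfl

/-! ### Wreath products -/

/-- `⊕_X Γ`: the finitely supported maps from `X` to `Γ`. -/
def FinSuppMaps (X : Type*) (Γ : Type*) [Group Γ] : Subgroup (X → Γ) where
  carrier := {g | (Function.mulSupport g).Finite}
  mul_mem' {g h} hg hh := (hg.union hh).subset (Function.mulSupport_mul g h)
  one_mem' := by simp
  inv_mem' {g} hg := by simpa [Function.mulSupport_inv] using hg

/-- The Bernoulli shift action `(v · g)(x) = g(v⁻¹ x)` on `⊕_X Γ`. -/
def bernoulliShift (G X Γ : Type*) [Group G] [MulAction G X] [Group Γ] :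
    G →* MulAut (FinSuppMaps X Γ) where
  toFun v :=
    { toFun := fun g => ⟨fun x => g.1 (v⁻¹ • x), by
        refine (g.2.image (v • ·)).subset fun x hx => ⟨v⁻¹ • x, hx, ?_⟩
        simp⟩
      invFun := fun g => ⟨fun x => g.1 (v • x), by
        refine (g.2.image (v⁻¹ • ·)).subset fun x hx => ⟨v • x, hx, ?_⟩
        simp⟩
      left_inv := fun g => by ext x; simp
      right_inv := fun g => by ext x; simp
      map_mul' := fun g h => rfl }
  map_one' := by ext g x; simp
  map_mul' v w := by ext g x; simp [mul_smul]

/-- The wreath product `⊕_X Γ ⋊ G` of a `G`-set `X`. -/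
abbrev WreathProd (G X Γ : Type*) [Group G] [MulAction G X] [Group Γ] : Type _ :=
  FinSuppMaps X Γ ⋊[bernoulliShift G X Γ] G

/-! ### Cells -/

/-! A `k`-ary tree is a `k`-adic subdivision of `[0, 1)`, so a symmetric forest from `n` to `m` is a
bijection `[0, n) → [0, m)` that carries each leaf interval affinely onto the unit cell of its
endpoint (`SymForest.cellPerm`). The group labels sit at left end points of cells: a first child has
the same left end point as its parent, so the rule `Θ(Y_k)(g) = (g, e, …, e)` is just transport of a
function supported at left end points (`cornerFun_Theta`). Hence `g ∘ f` acts as a `Γ`-twisted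
bijection `[0, n) × Γ → [0, m) × Γ`, and this functor extends to the universal groupoid. The wreath
product acts on `[0, r) × Γ` by twisted bijections as well. The theorem follows once both actions
are faithful and have the same image.

Faithfulness of the groupoid action: for `k ≥ 2` a morphism is determined by its action
(`ForestCat.Mor.act_injective`), and any two forests with the same roots extend to one complete
forest (`SymForest.exists_comp_eq_comp`). So there is a calculus of fractions, every groupoid
morphism is some `v⁻¹ ∘ u`, and it acts trivially only if `u = v`.

Equality of images: a quotient of two forests is affine on leaf intervals, and its labels sit at
finitely many `k`-adic points (`mem_range_wreathAct_of_trans_act`). Conversely, for `(g, t)` in the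
wreath product and `N` large, multiplication by `k^N` and `t⁻¹` followed by it both come from
forests, and all values of `g` sit at corners of cells. This writes `(g, t)` as a fraction
(`exists_wreathAct_trans_act`). -/

/-- The half-open unit interval, the leaf cell on which trees act. -/
abbrev UnitCell : Type := Set.Ico (0 : ℝ) 1

/-- The point `i + u` of `[0, m)`. -/
def cellVal {m : ℕ} (x : Fin m × UnitCell) : ℝ := (x.1 : ℕ) + (x.2 : ℝ)

/-- Integer and fractional parts of a real number are unique. -/
theorem int_add_unitCell_inj {a b : ℤ} {u v : UnitCell} (h : (a : ℝ) + u = b + v) :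
    a = b ∧ u = v := by
  have hu := u.2
  have hv := v.2
  have h1 : a < b + 1 := by
    have : (a : ℝ) < b + 1 := by linarith [hu.1, hv.2]
    exact_mod_cast this
  have h2 : b < a + 1 := by
    have : (b : ℝ) < a + 1 := by linarith [hv.1, hu.2]
    exact_mod_cast this
  have h3 : a = b := by omega
  subst h3
  exact ⟨rfl, Subtype.ext (by linarith)⟩

theorem exists_int_add_unitCell (y : ℝ) : ∃ (a : ℤ) (w : UnitCell), y = a + w :=
  ⟨⌊y⌋, ⟨Int.fract y, Int.fract_nonneg y, Int.fract_lt_one y⟩, (Int.floor_add_fract y).symm⟩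

section cellVal

variable {m : ℕ}

theorem cellVal_injective : Function.Injective (cellVal (m := m)) := by
  rintro ⟨i, u⟩ ⟨j, v⟩ h
  have := int_add_unitCell_inj (a := (i : ℕ)) (b := (j : ℕ)) (u := u) (v := v)
    (by simpa [cellVal] using h)
  exact Prod.ext (Fin.ext (by exact_mod_cast this.1)) this.2

theorem cellVal_nonneg (x : Fin m × UnitCell) : 0 ≤ cellVal x :=
  add_nonneg (Nat.cast_nonneg _) x.2.2.1

theorem cellVal_lt (x : Fin m × UnitCell) : cellVal x < m := by
  have h : ((x.1 : ℕ) : ℝ) + 1 ≤ m := by exact_mod_cast x.1.2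
  have := x.2.2.2
  unfold cellVal
  linarith

theorem exists_cell {a : ℤ} {w : UnitCell} (h0 : 0 ≤ (a : ℝ) + w) (h1 : (a : ℝ) + w < m) :
    ∃ j : Fin m, ((j : ℕ) : ℤ) = a := by
  have hw := w.2
  have h2 : -1 < a := by
    have : (-1 : ℝ) < a := by linarith [hw.2]
    exact_mod_cast this
  have h3 : a < m := by
    have : (a : ℝ) < m := by linarith [hw.1]
    exact_mod_cast this
  exact ⟨⟨a.toNat, by omega⟩, by simp; omega⟩

theorem exists_cellVal_eq {y : ℝ} (h0 : 0 ≤ y) (h1 : y < m) :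
    ∃ x : Fin m × UnitCell, cellVal x = y := by
  obtain ⟨a, w, rfl⟩ := exists_int_add_unitCell y
  obtain ⟨j, hj⟩ := exists_cell h0 h1
  exact ⟨(j, w), by simp [cellVal, ← hj]⟩

/-- `[0, m)` is the disjoint union of `m` unit cells. -/
noncomputable def cellEquiv (m : ℕ) : Fin m × UnitCell ≃ Set.Ico (0 : ℝ) m :=
  Equiv.ofBijective (fun x => ⟨cellVal x, cellVal_nonneg x, cellVal_lt x⟩)
    ⟨fun _ _ h => cellVal_injective (congrArg Subtype.val h),
      fun y => (exists_cellVal_eq y.2.1 y.2.2).imp fun _ h => Subtype.ext h⟩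

theorem coe_cellEquiv (x : Fin m × UnitCell) : (cellEquiv m x : ℝ) = cellVal x := rfl

theorem cellVal_cellEquiv_symm (y : Set.Ico (0 : ℝ) m) : cellVal ((cellEquiv m).symm y) = y := by
  rw [← coe_cellEquiv, Equiv.apply_symm_apply]

end cellVal

/-- Multiplication by `K`, from `[0, n)` to `[0, n * K)`, in terms of unit cells. -/
theorem exists_scale (n K : ℕ) (hK : 0 < K) : ∃ e : Fin n × UnitCell ≃ Fin (n * K) × UnitCell,
    ∀ x, cellVal (e x) = K * cellVal x := by
  have hK' : (0 : ℝ) < K := by exact_mod_cast hK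
  have h : ∀ x : Fin n × UnitCell, ∃ y : Fin (n * K) × UnitCell, cellVal y = K * cellVal x :=
    fun x => exists_cellVal_eq (mul_nonneg hK'.le (cellVal_nonneg x)) (by
      push_cast
      nlinarith [cellVal_lt x])
  choose f hf using h
  refine ⟨Equiv.ofBijective f ⟨fun x y hxy => cellVal_injective ?_, fun y => ?_⟩, hf⟩
  · have := hf x
    rw [hxy, hf y] at this
    exact (mul_left_cancel₀ hK'.ne' this).symm
  · obtain ⟨x, hx⟩ := exists_cellVal_eq (m := n) (y := cellVal y / K)
      (div_nonneg (cellVal_nonneg y) hK'.le) (by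
        rw [div_lt_iff₀ hK']
        exact_mod_cast cellVal_lt y)
    refine ⟨x, cellVal_injective ?_⟩
    rw [hf, hx]
    field_simp

theorem exists_subdivision (k : ℕ) [NeZero k] : ∃ e : UnitCell ≃ Fin k × UnitCell,
    ∀ u, cellVal (e u) = k * u := by
  obtain ⟨e, he⟩ := exists_scale 1 k (NeZero.pos k)
  refine ⟨(Equiv.uniqueProd UnitCell (Fin 1)).symm.trans
    (e.trans (Equiv.prodCongr (finCongr (one_mul k)) (Equiv.refl _))), fun u => ?_⟩
  have := he (0, u)
  simpa [cellVal] using this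

/-- The first `k`-adic digit of `u` and the remaining part of its expansion. -/
noncomputable def subdivide (k : ℕ) [NeZero k] : UnitCell ≃ Fin k × UnitCell :=
  (exists_subdivision k).choose

section subdivide

variable {k : ℕ} [NeZero k]

theorem cellVal_subdivide (u : UnitCell) : cellVal (subdivide k u) = k * u :=
  (exists_subdivision k).choose_spec u

theorem mul_subdivide_symm (x : Fin k × UnitCell) :
    (k : ℝ) * ((subdivide k).symm x : UnitCell) = (x.1 : ℕ) + (x.2 : ℝ) := by
  rw [← cellVal_subdivide, Equiv.apply_symm_apply, cellVal]

theorem subdivide_zero : subdivide k 0 = (0, 0) := by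
  apply cellVal_injective
  rw [cellVal_subdivide]
  simp [cellVal]

end subdivide

/-! ### The action of trees and forests -/

namespace KTree

variable {k : ℕ} [NeZero k] {X Y : Type}

/-- The leaf reached from the root by following the `k`-adic digits of `u`, and the remaining part
of the expansion of `u`. -/
noncomputable def eval : KTree k X → UnitCell → X × UnitCell
  | leaf x, u => (x, u)
  | node c, u => (c (subdivide k u).1).eval (subdivide k u).2

theorem eval_graft (t : KTree k X) (F : X → KTree k Y) (u : UnitCell) :
    (t.graft F).eval u = (F (t.eval u).1).eval (t.eval u).2 := by
  induction t generalizing u with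
  | leaf x => rfl
  | node c ih => simp only [graft, eval, ih]

variable [DecidableEq X]

/-- Every point of the leaf cell of `x` is reached once from each leaf labelled `x`. -/
theorem nonempty_eval_fiber_equiv (t : KTree k X) (x : X) (w : UnitCell) :
    Nonempty ({u // t.eval u = (x, w)} ≃ Fin (t.count x)) := by
  induction t with
  | leaf y =>
    by_cases h : y = x
    · subst h
      simp only [eval, count, if_true, Prod.mk.injEq, true_and]
      exact ⟨Equiv.ofUnique _ _⟩
    · simp only [eval, count, h, if_false, Prod.mk.injEq, false_and]
      exact ⟨Equiv.equivOfIsEmpty _ _⟩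
  | node c ih =>
    exact ⟨((subdivide k).subtypeEquiv fun _ => Iff.rfl).trans
      ((Equiv.subtypeProdEquivSigmaSubtype fun i u => (c i).eval u = (x, w)).trans
        ((Equiv.sigmaCongrRight fun i => (ih i).some).trans finSigmaFinEquiv))⟩

theorem count_ne_zero_of_eval_eq {t : KTree k X} {u w : UnitCell} {x : X}
    (h : t.eval u = (x, w)) : t.count x ≠ 0 := by
  obtain ⟨e⟩ := t.nonempty_eval_fiber_equiv x w
  have := (e ⟨u, h⟩).pos
  omega

/-- The number of leaves labelled `x` is the size of the fibre of `eval` over the single point `(x,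
0)`. -/
theorem count_congr {s t : KTree k X} (h : s.eval = t.eval) (x : X) : s.count x = t.count x := by
  obtain ⟨e⟩ := s.nonempty_eval_fiber_equiv x 0
  obtain ⟨e'⟩ := t.nonempty_eval_fiber_equiv x 0
  rw [h] at e
  exact Fin.equiv_iff_eq.1 ⟨e.symm.trans e'⟩

theorem one_le_sum_count [Fintype X] (t : KTree k X) : 1 ≤ ∑ x, t.count x := by
  refine (Nat.one_le_iff_ne_zero.2 (count_ne_zero_of_eval_eq (t := t) (u := 0) (w := (t.eval 0).2) rfl)).trans
    (Finset.single_le_sum (f := fun x => t.count x) (fun _ _ => Nat.zero_le _) (Finset.mem_univ _))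

/-- Equal maps have equally many leaves, but a leaf has one and a node at least `k ≥ 2`. For `k = 1`
a unary vertex would act as the identity. -/
theorem leaf_eval_ne_node_eval [Fintype X] (hk : 2 ≤ k) (x : X) (c : Fin k → KTree k X) :
    (leaf x : KTree k X).eval ≠ (node c).eval := by
  intro h
  have h1 : ∑ y, (leaf x : KTree k X).count y = ∑ y, (node c).count y :=
    Finset.sum_congr rfl fun y _ => count_congr h y
  have h2 : ∑ y, (leaf x : KTree k X).count y = 1 := by simp [count]
  have h3 : k ≤ ∑ y, (node c).count y := by
    simp only [count]
    rw [Finset.sum_comm]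
    calc k = ∑ _i : Fin k, 1 := by simp
      _ ≤ _ := Finset.sum_le_sum fun i _ => one_le_sum_count (c i)
  omega

theorem eval_injective [Fintype X] (hk : 2 ≤ k) :
    Function.Injective (eval : KTree k X → UnitCell → X × UnitCell) := by
  intro s
  induction s with
  | leaf x =>
    rintro (y | c) h
    · have := congrFun h 0
      simp only [eval, Prod.mk.injEq] at this
      rw [this.1]
    · exact (leaf_eval_ne_node_eval hk x c h).elim
  | node c ih =>
    rintro (y | c') h
    · exact (leaf_eval_ne_node_eval hk y c h.symm).elim
    · congr 1
      funext i
      refine ih i (funext fun u => ?_)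
      simpa [eval] using congrFun h ((subdivide k).symm (i, u))

/-- A group element sitting at the left end point of the root cell is pushed to the leaf whose
left end point it is. -/
theorem push_id_eq {Γ : Type*} [Group Γ] (t : KTree k X) {x : X} {u w : UnitCell}
    (hx : t.count x ≤ 1) (h : t.eval u = (x, w)) (g : Γ) :
    (if u = 0 then g else 1) = if w = 0 then t.push (MonoidHom.id Γ) x g else 1 := by
  induction t generalizing u with
  | leaf y =>
    obtain ⟨rfl, rfl⟩ := Prod.mk.inj h
    simp [push]
  | node c ih =>
    obtain ⟨⟨i, v⟩, rfl⟩ := (subdivide k).symm.surjective u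
    simp only [eval, Equiv.apply_symm_apply] at h
    have hle : ∀ j, (c j).count x ≤ 1 := fun j =>
      (Finset.single_le_sum (f := fun j => (c j).count x) (fun _ _ => Nat.zero_le _)
        (Finset.mem_univ j)).trans hx
    have h0 : (subdivide k).symm (i, v) = 0 ↔ i = 0 ∧ v = 0 := by
      rw [Equiv.symm_apply_eq, subdivide_zero, Prod.mk.injEq]
    simp only [h0, push, NeZero.pos k, dif_pos, MonoidHom.id_apply]
    by_cases hi : i = 0
    · subst hi
      simpa using ih 0 (hle 0) h
    -- The only leaf labelled `x` lies above child `i ≠ 0`, so nothing reaches it from the root; and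
    -- `u`, lying in a later child interval, is not `0`. Both sides are `1`.
    · have hc : (c 0).count x = 0 := by
        by_contra hc
        have h2 := Finset.add_le_sum (f := fun i => (c i).count x) (s := Finset.univ)
          (fun _ _ => Nat.zero_le _) (Finset.mem_univ i) (Finset.mem_univ 0) hi
        have := count_ne_zero_of_eval_eq h
        simp only [count] at hx
        omega
      have := push_of_count_eq_zero (MonoidHom.id Γ) x _ hc g
      rw [show (⟨0, NeZero.pos k⟩ : Fin k) = 0 from rfl, this]
      simp [hi]

/-- The tree maps an interval affinely onto the cell of each leaf. -/
theorem exists_affine (t : KTree k X) {x : X} (h : t.count x ≠ 0) :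
    ∃ (d : ℕ) (a : ℤ), ∀ w : UnitCell, ∃ u : UnitCell, (k : ℝ) ^ d * u = a + w ∧
      t.eval u = (x, w) := by
  induction t with
  | leaf y =>
    have : y = x := by by_contra hne; simp [count, hne] at h
    subst this
    exact ⟨0, 0, fun w => ⟨w, by simp, rfl⟩⟩
  | node c ih =>
    obtain ⟨i, -, hi⟩ := Finset.exists_ne_zero_of_sum_ne_zero h
    obtain ⟨d, a, hda⟩ := ih i hi
    -- The point of child `i` with coordinate `u` is `(i + u) / k`, and `k^(d+1)` times it is `k^d *
    -- i + k^d * u`.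
    refine ⟨d + 1, k ^ d * (i : ℕ) + a, fun w => ?_⟩
    obtain ⟨u, hu, hw⟩ := hda w
    refine ⟨(subdivide k).symm (i, u), ?_, by simpa [eval] using hw⟩
    rw [pow_succ, mul_assoc, mul_subdivide_symm]
    push_cast
    linear_combination hu

end KTree

/-! ### Recognising the maps that come from trees and forests -/

/-- `f` maps the interval `[a / k^d, (a + 1) / k^d)` around each point, for some `d ≤ D`,
affinely onto a unit cell. Here `ι` is the coordinate on the source. -/
def IsPiecewiseStandard (k D : ℕ) {A X : Type} (ι : A → ℝ) (f : A → X × UnitCell) : Prop :=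
  ∀ x, ∃ d ≤ D, ∃ (a : ℤ) (j : X), (∃ w : UnitCell, (k : ℝ) ^ d * ι x = a + w) ∧
    ∀ (x' : A) (w : UnitCell), (k : ℝ) ^ d * ι x' = a + w → f x' = (j, w)

/-- Induction on the depth bound `D`. If some point admits `d = 0`, the whole interval is one piece
and the tree is a leaf. Otherwise every `d` is positive, and restricting to a child interval lowers
it by one. -/
theorem IsPiecewiseStandard.exists_tree {k D : ℕ} [NeZero k] {X : Type}
    {f : UnitCell → X × UnitCell} (hf : IsPiecewiseStandard k D Subtype.val f) :
    ∃ t : KTree k X, t.eval = f := by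
  have leaf_case : ∀ (f : UnitCell → X × UnitCell) (x : UnitCell) (a : ℤ) (j : X),
      (∃ w : UnitCell, (k : ℝ) ^ 0 * x = a + w) →
      (∀ x' w : UnitCell, (k : ℝ) ^ 0 * x' = a + w → f x' = (j, w)) →
      ∃ t : KTree k X, t.eval = f := by
    rintro f x a j ⟨w, hw⟩ h
    -- At depth `0` the standard interval around a point of `[0, 1)` is `[0, 1)` itself, so `a = 0`.
    obtain ⟨rfl, -⟩ := int_add_unitCell_inj (a := 0) (u := x) (b := a) (v := w) (by simpa using hw)
    exact ⟨.leaf j, funext fun u => (h u u (by simp)).symm⟩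
  induction D generalizing f with
  | zero =>
    obtain ⟨d, hd, a, j, h1, h2⟩ := hf 0
    obtain rfl : d = 0 := by omega
    exact leaf_case f 0 a j h1 h2
  | succ D ih =>
    by_cases hl : ∃ t : KTree k X, t.eval = f
    · exact hl
    have : ∀ i : Fin k, ∃ t : KTree k X, t.eval = fun u => f ((subdivide k).symm (i, u)) := by
      refine fun i => ih fun u => ?_
      obtain ⟨d, hd, a, j, h1, h2⟩ := hf ((subdivide k).symm (i, u))
      rcases d with - | d
      · exact (hl (leaf_case f _ a j h1 h2)).elim
      refine ⟨d, by omega, a - k ^ d * (i : ℕ), j, ?_, fun u' w hw => h2 _ _ ?_⟩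
      · obtain ⟨w, hw⟩ := h1
        refine ⟨w, ?_⟩
        rw [pow_succ, mul_assoc, mul_subdivide_symm] at hw
        push_cast
        linear_combination hw
      · rw [pow_succ, mul_assoc, mul_subdivide_symm]
        push_cast at hw
        linear_combination hw
    choose c hc using this
    refine ⟨.node c, funext fun u => ?_⟩
    simp [KTree.eval, hc]

namespace SymForest

variable {k n m l : ℕ} [NeZero k]

/-- The map `[0, n) → [0, m)` that maps the intervals of the leaves affinely onto unit cells. -/
noncomputable def cellMap (p : SymForest k n m) (x : Fin n × UnitCell) : Fin m × UnitCell :=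
  (p.tree x.1).eval x.2

/-- The fibre over a point of cell `j` has as many elements as there are leaves labelled `j` in the
forest, namely one. -/
theorem cellMap_bijective (p : SymForest k n m) : Function.Bijective p.cellMap := by
  rw [Function.bijective_iff_existsUnique]
  rintro ⟨j, w⟩
  have e : {x // p.cellMap x = (j, w)} ≃ Fin (∑ i, (p.tree i).count j) :=
    (Equiv.subtypeProdEquivSigmaSubtype fun i u => (p.tree i).eval u = (j, w)).trans
      ((Equiv.sigmaCongrRight fun i =>
        ((p.tree i).nonempty_eval_fiber_equiv j w).some).trans finSigmaFinEquiv)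
  rw [p.count_eq] at e
  exact (unique_subtype_iff_existsUnique _).1 ⟨e.unique⟩

/-- `cellMap` as a bijection. -/
noncomputable def cellPerm (p : SymForest k n m) : Fin n × UnitCell ≃ Fin m × UnitCell :=
  Equiv.ofBijective p.cellMap p.cellMap_bijective

theorem cellPerm_id : (id k n).cellPerm = Equiv.refl _ := Equiv.ext fun _ => rfl

theorem cellPerm_comp (q : SymForest k m l) (p : SymForest k n m) :
    (q.comp p).cellPerm = p.cellPerm.trans q.cellPerm :=
  Equiv.ext fun _ => KTree.eval_graft _ _ _

theorem cellPerm_injective (hk : 2 ≤ k) :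
    Function.Injective (cellPerm : SymForest k n m → (Fin n × UnitCell ≃ Fin m × UnitCell)) := by
  intro p q h
  refine SymForest.ext (funext fun i => KTree.eval_injective hk (funext fun u => ?_))
  exact Equiv.congr_fun h (i, u)

theorem root_of_cellPerm_eq {p : SymForest k n m} {x : Fin n × UnitCell} {j : Fin m} {w : UnitCell}
    (h : p.cellPerm x = (j, w)) : p.root j = x.1 :=
  p.root_eq (KTree.count_ne_zero_of_eval_eq h)

theorem exists_affine (p : SymForest k n m) (j : Fin m) :
    ∃ (d : ℕ) (a : ℤ), ∀ w : UnitCell, (k : ℝ) ^ d * cellVal (p.cellPerm.symm (j, w)) = a + w := by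
  obtain ⟨i, hi, -⟩ := p.existsUnique_root j
  obtain ⟨d, a, h⟩ := (p.tree i).exists_affine hi
  refine ⟨d, k ^ d * (i : ℕ) + a, fun w => ?_⟩
  obtain ⟨u, hu, hw⟩ := h w
  rw [show p.cellPerm.symm (j, w) = (i, u) from (Equiv.symm_apply_eq _).2 hw.symm]
  simp only [cellVal]
  push_cast
  linear_combination hu

end SymForest

theorem IsPiecewiseStandard.exists_forest {k D n m : ℕ} [NeZero k]
    {f : Fin n × UnitCell ≃ Fin m × UnitCell} (hf : IsPiecewiseStandard k D cellVal f) :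
    ∃ p : SymForest k n m, p.cellPerm = f := by
  have : ∀ i : Fin n, ∃ t : KTree k (Fin m), t.eval = fun u => f (i, u) := by
    refine fun i => exists_tree (D := D) fun u => ?_
    obtain ⟨d, hd, a, j, h1, h2⟩ := hf (i, u)
    refine ⟨d, hd, a - k ^ d * (i : ℕ), j, ?_, fun u' w hw => h2 _ _ ?_⟩
    · obtain ⟨w, hw⟩ := h1
      refine ⟨w, ?_⟩
      simp only [cellVal] at hw
      push_cast
      linear_combination hw
    · simp only [cellVal]
      push_cast at hw
      linear_combination hw
  choose t ht using this
  refine ⟨⟨t, fun j => ?_⟩, Equiv.ext fun x => congrFun (ht x.1) x.2⟩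
  -- The same fibre count backwards: bijectivity of `f` forces every label to occur exactly once.
  have e : {x // f x = (j, 0)} ≃ Fin (∑ i, (t i).count j) :=
    ((Equiv.refl _).subtypeEquiv fun x => by rw [ht]; rfl).trans
      ((Equiv.subtypeProdEquivSigmaSubtype fun i u => (t i).eval u = (j, 0)).trans
        ((Equiv.sigmaCongrRight fun i =>
          ((t i).nonempty_eval_fiber_equiv j 0).some).trans finSigmaFinEquiv))
  have e' : {x // f x = (j, 0)} ≃ Fin 1 :=
    (f.subtypeEquiv (q := fun y => y = (j, 0)) fun x => Iff.rfl).trans (Equiv.ofUnique _ _)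
  exact Fin.equiv_iff_eq.1 ⟨e.symm.trans e'⟩

theorem eq_of_cellVal_eq {m : ℕ} {x : Fin m × UnitCell} {a : ℤ} {w : UnitCell}
    (h : cellVal x = a + w) : ((x.1 : ℕ) : ℤ) = a ∧ x.2 = w :=
  int_add_unitCell_inj (by simpa [cellVal] using h)

/-- If `[b / K, (b + 1) / K)` meets the unit interval, then it is contained in it. -/
theorem mem_unitCell_of_mul_eq {K : ℕ} (hK : 0 < K) {b : ℤ} {w v v' : UnitCell} {y : ℝ}
    (h : (K : ℝ) * w = b + v) (hy : (K : ℝ) * y = b + v') : y ∈ Set.Ico (0 : ℝ) 1 := by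
  have hv := v.2
  have hv' := v'.2
  have hw := w.2
  have hK' : (0 : ℝ) < K := by exact_mod_cast hK
  have h0 : -1 < b := by
    have : (-1 : ℝ) < b := by linarith [mul_nonneg hK'.le hw.1, hv.2]
    exact_mod_cast this
  have h1 : b < K := by
    have : (b : ℝ) < K := by linarith [mul_lt_mul_of_pos_left hw.2 hK', hv.1]
    exact_mod_cast this
  have h2 : (0 : ℝ) ≤ b := by exact_mod_cast (by omega : 0 ≤ b)
  have h3 : (b : ℝ) + 1 ≤ K := by exact_mod_cast (by omega : b + 1 ≤ K)
  constructor
  · exact nonneg_of_mul_nonneg_right (by linarith [hv'.1]) hK'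
  · exact lt_of_mul_lt_mul_left (a := (K : ℝ)) (by linarith [hv'.2]) hK'.le

/-! ### Twisted bijections -/

section twist

variable {A B C Γ : Type*} [Group Γ]

/-- The bijection over `φ` between trivial `Γ`-torsors that multiplies by `h`. -/
def twist (φ : A ≃ B) (h : B → Γ) : A × Γ ≃ B × Γ where
  toFun x := (φ x.1, h (φ x.1) * x.2)
  invFun y := (φ.symm y.1, (h y.1)⁻¹ * y.2)
  left_inv x := by simp
  right_inv y := by simp

theorem twist_apply (φ : A ≃ B) (h : B → Γ) (x : A × Γ) :
    twist φ h x = (φ x.1, h (φ x.1) * x.2) := rfl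

/-- This cocycle rule is the composition law of the category (through `cornerFun_Theta`) and also
the multiplication of the wreath product (through `extendKadic_bernoulliShift`). -/
theorem twist_trans (φ : A ≃ B) (h : B → Γ) (ψ : B ≃ C) (h' : C → Γ) :
    (twist φ h).trans (twist ψ h') = twist (φ.trans ψ) fun c => h' c * h (ψ.symm c) := by
  ext x <;> simp [twist_apply, mul_assoc]

theorem twist_symm (φ : A ≃ B) (h : B → Γ) :
    (twist φ h).symm = twist φ.symm fun a => (h (φ a))⁻¹ := by
  ext x <;> simp [twist]

theorem twist_inj {φ φ' : A ≃ B} {h h' : B → Γ} : twist φ h = twist φ' h' ↔ φ = φ' ∧ h = h' := by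
  refine ⟨fun e => ?_, fun e => by rw [e.1, e.2]⟩
  have e1 : φ = φ' := Equiv.ext fun a => congrArg Prod.fst (Equiv.congr_fun e (a, 1))
  subst e1
  refine ⟨rfl, funext fun b => ?_⟩
  have := congrArg Prod.snd (Equiv.congr_fun e (φ.symm b, 1))
  simpa [twist_apply] using this

end twist

/-- The groupoid of bijections between the sets `[0, n) × Γ`. -/
structure CellBundle (Γ : Type*) where
  rank : ℕ

instance CellBundle.instGroupoid (Γ : Type*) : Groupoid (CellBundle Γ) where
  Hom a b := (Fin a.rank × UnitCell) × Γ ≃ (Fin b.rank × UnitCell) × Γ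
  id _ := Equiv.refl _
  comp f g := f.trans g
  inv f := f.symm
  id_comp _ := rfl
  comp_id _ := rfl
  assoc _ _ _ := rfl
  inv_comp f := f.symm_trans_self
  comp_inv f := f.self_trans_symm

/-! ### The action of the category -/

section action

variable {k : ℕ} [NeZero k] {Γ : Type*} [Group Γ] {n m l : ℕ}

/-- The function on `[0, m)` supported at the left end points of the unit cells, with given
values there. -/
noncomputable def cornerFun (g : Fin m → Γ) (x : Fin m × UnitCell) : Γ :=
  if x.2 = 0 then g x.1 else 1

theorem cornerFun_corner (g : Fin m → Γ) (j : Fin m) : cornerFun g (j, 0) = g j := if_pos rfl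

theorem cornerFun_injective :
    Function.Injective (cornerFun : (Fin m → Γ) → Fin m × UnitCell → Γ) := fun g h e =>
  funext fun j => by rw [← cornerFun_corner g, e, cornerFun_corner]

theorem cornerFun_one : cornerFun (1 : Fin m → Γ) = 1 := by
  funext x
  simp [cornerFun]

theorem cornerFun_mul (g h : Fin m → Γ) (x : Fin m × UnitCell) :
    cornerFun (g * h) x = cornerFun g x * cornerFun h x := by
  by_cases hx : x.2 = 0 <;> simp [cornerFun, hx]

/-- This is where `θ = id` enters: labels pushed through `q` are unchanged and follow the left end
points, so `Θ(q)` becomes precomposition with the inverse bijection. -/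
theorem cornerFun_Theta (q : SymForest k m l) (g : Fin m → Γ) (y : Fin l × UnitCell) :
    cornerFun (q.Theta (MonoidHom.id Γ) g) y = cornerFun g (q.cellPerm.symm y) := by
  obtain ⟨x, rfl⟩ := q.cellPerm.surjective y
  rw [Equiv.symm_apply_apply]
  have hr := q.root_of_cellPerm_eq (x := x) (j := (q.cellPerm x).1) (w := (q.cellPerm x).2) rfl
  have hc : (q.tree x.1).count (q.cellPerm x).1 ≤ 1 := by
    rw [← q.count_eq (q.cellPerm x).1]
    exact Finset.single_le_sum (f := fun i => (q.tree i).count (q.cellPerm x).1)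
      (fun _ _ => Nat.zero_le _) (Finset.mem_univ _)
  have := (q.tree x.1).push_id_eq hc (u := x.2) (w := (q.cellPerm x).2) rfl (g x.1)
  simp only [cornerFun, SymForest.Theta, MonoidHom.coe_mk, OneHom.coe_mk]
  rw [hr]
  exact this.symm

/-- The bijection `[0, n) × Γ → [0, m) × Γ` given by a morphism from `n` to `m`. -/
noncomputable def ForestCat.Mor.act (u : ForestCat.Mor k Γ n m) :
    (Fin n × UnitCell) × Γ ≃ (Fin m × UnitCell) × Γ :=
  twist u.forest.cellPerm (cornerFun u.label)

theorem ForestCat.Mor.act_injective (hk : 2 ≤ k) :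
    Function.Injective (ForestCat.Mor.act :
      ForestCat.Mor k Γ n m → ((Fin n × UnitCell) × Γ ≃ (Fin m × UnitCell) × Γ)) := by
  intro u v h
  obtain ⟨h1, h2⟩ := twist_inj.1 h
  exact ForestCat.Mor.ext (SymForest.cellPerm_injective hk h1) (cornerFun_injective h2)

/-- The functor to the groupoid of bijections. -/
noncomputable def cellFunctor (k : ℕ) [NeZero k] (Γ : Type*) [Group Γ] :
    ForestCat k (MonoidHom.id Γ) ⥤ CellBundle Γ where
  obj a := ⟨a.rank⟩
  map u := ForestCat.Mor.act u
  map_id a := by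
    change twist (SymForest.id k a.rank).cellPerm (cornerFun 1) = Equiv.refl _
    rw [SymForest.cellPerm_id, cornerFun_one]
    ext x <;> simp [twist_apply]
  map_comp {a b c} (u : ForestCat.Mor k Γ _ _) (v : ForestCat.Mor k Γ _ _) := by
    change twist (v.forest.comp u.forest).cellPerm
      (cornerFun (v.label * v.forest.Theta (MonoidHom.id Γ) u.label)) = (u.act).trans v.act
    rw [ForestCat.Mor.act, ForestCat.Mor.act, twist_trans, SymForest.cellPerm_comp]
    congr 1
    funext y
    rw [cornerFun_mul, cornerFun_Theta]

end action

/-! ### Calculus of fractions -/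

namespace SymForest

variable {k n m : ℕ} [NeZero k]

/-- Every forest extends to the complete forest of depth `N`, for all large `N`. -/
theorem exists_comp_scale (p : SymForest k n m) : ∃ N₀ : ℕ, ∀ N ≥ N₀,
    ∃ q : SymForest k m (n * k ^ N), ∀ x, cellVal ((q.comp p).cellPerm x) = k ^ N * cellVal x := by
  choose d a hda using p.exists_affine
  refine ⟨Finset.univ.sup d, fun N hN => ?_⟩
  have hd : ∀ j, d j ≤ N := fun j => (Finset.le_sup (Finset.mem_univ j)).trans hN
  obtain ⟨e, he⟩ := exists_scale n (k ^ N) (pow_pos (NeZero.pos k) N)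
  push_cast at he
  -- Leaf `j` has depth `d j`, so it still has to be subdivided `N - d j` times; the forest `q` has
  -- to realise this enlargement of cell `j` by `k^(N - d j)`.
  have hval : ∀ j (w : UnitCell),
      cellVal (p.cellPerm.symm.trans e (j, w)) = k ^ (N - d j) * (a j + w) := by
    intro j w
    rw [Equiv.trans_apply, he, ← hda, ← mul_assoc, ← pow_add, Nat.sub_add_cancel (hd j)]
  have hf : IsPiecewiseStandard k N cellVal (p.cellPerm.symm.trans e) := by
    rintro ⟨j, w⟩
    -- The piece around `(j, w)` is the subinterval of cell `j` of depth `N - d j` that contains it,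
    -- with index `b`.
    obtain ⟨b, v, hb⟩ := exists_int_add_unitCell ((k : ℝ) ^ (N - d j) * w)
    refine ⟨N - d j, Nat.sub_le _ _, k ^ (N - d j) * (j : ℕ) + b,
      (p.cellPerm.symm.trans e (j, w)).1, ⟨v, ?_⟩, ?_⟩
    · simp only [cellVal]
      push_cast
      linear_combination hb
    · rintro x' v' h
      have hy : (k : ℝ) ^ (N - d j) * (cellVal x' - (j : ℕ)) = b + v' := by
        push_cast at h
        linear_combination h
      have hmem := mem_unitCell_of_mul_eq (pow_pos (NeZero.pos k) (N - d j)) (by exact_mod_cast hb)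
        (by exact_mod_cast hy)
      have hx : x' = (j, ⟨_, hmem⟩) := cellVal_injective (by simp [cellVal])
      rw [hx]
      have h1 := eq_of_cellVal_eq (a := k ^ (N - d j) * a j + b) (w := v) ((hval j w).trans (by
        push_cast
        linear_combination hb))
      have h2 := eq_of_cellVal_eq (a := k ^ (N - d j) * a j + b) (w := v') ((hval j ⟨_, hmem⟩).trans (by
        push_cast
        linear_combination hy))
      exact Prod.ext (Fin.ext (by exact_mod_cast h2.1.trans h1.1.symm)) h2.2
  obtain ⟨q, hq⟩ := hf.exists_forest
  exact ⟨q, fun x => by simp [cellPerm_comp, hq, he]⟩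

/-- Both forests extend to the complete forest of depth `max N N'`. The two composites act as
multiplication by the same power of `k`, hence coincide by faithfulness. -/
theorem exists_comp_eq_comp {l : ℕ} (hk : 2 ≤ k) (hn : 0 < n) (p : SymForest k n m)
    (p' : SymForest k n l) :
    ∃ (M : ℕ+) (q : SymForest k m M) (q' : SymForest k l M), q.comp p = q'.comp p' := by
  obtain ⟨N, hN⟩ := p.exists_comp_scale
  obtain ⟨N', hN'⟩ := p'.exists_comp_scale
  obtain ⟨q, hq⟩ := hN (max N N') (le_max_left _ _)
  obtain ⟨q', hq'⟩ := hN' (max N N') (le_max_right _ _)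
  exact ⟨⟨_, mul_pos hn (pow_pos (NeZero.pos k) _)⟩, q, q', cellPerm_injective hk
    (Equiv.ext fun x => cellVal_injective ((hq x).trans (hq' x).symm))⟩

end SymForest

/-! ### Fractions and the faithful action of the universal groupoid -/

namespace ForestCat

variable {k : ℕ} [NeZero k] {Γ : Type*} [Group Γ]

theorem hasLeftCalculusOfFractions (hk : 2 ≤ k) :
    (⊤ : MorphismProperty (ForestCat k (MonoidHom.id Γ))).HasLeftCalculusOfFractions where
  exists_leftFraction {a b} φ := by
    let u : Mor k Γ φ.X'.rank a.rank := φ.s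
    let v : Mor k Γ φ.X'.rank b.rank := φ.f
    obtain ⟨M, q, q', h⟩ := SymForest.exists_comp_eq_comp hk φ.X'.rank.pos u.forest v.forest
    let c : ForestCat k (MonoidHom.id Γ) := ⟨M⟩
    -- These labels cancel the labels of `u` and `v` pushed through `q` and `q'`, so both composites
    -- have label `1`.
    let s : Mor k Γ a.rank M := ⟨q, (q.Theta (MonoidHom.id Γ) u.label)⁻¹⟩
    let t : Mor k Γ b.rank M := ⟨q', (q'.Theta (MonoidHom.id Γ) v.label)⁻¹⟩
    refine ⟨MorphismProperty.LeftFraction.mk (Y' := c) s t trivial,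
      Mor.ext h.symm ?_⟩
    exact (inv_mul_cancel _).trans (inv_mul_cancel _).symm
  -- Every morphism is already epi in the category, since its action is invertible and actions are
  -- faithful; the identity therefore serves as the equalising morphism.
  ext {a' a b} f₁ f₂ s _ h := by
    refine ⟨b, 𝟙 b, trivial, ?_⟩
    rw [Category.comp_id, Category.comp_id]
    have := congrArg (cellFunctor k Γ).map h
    rw [Functor.map_comp, Functor.map_comp, cancel_epi] at this
    exact Mor.act_injective hk this

theorem exists_comp_homMk_eq (hk : 2 ≤ k) {a b : ForestCat k (MonoidHom.id Γ)}
    (f : FreeGroupoid.mk a ⟶ FreeGroupoid.mk b) :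
    ∃ (c : ForestCat k (MonoidHom.id Γ)) (u : a ⟶ c) (v : b ⟶ c),
      f ≫ FreeGroupoid.homMk v = FreeGroupoid.homMk u := by
  have := hasLeftCalculusOfFractions (Γ := Γ) hk
  obtain ⟨φ, hφ⟩ := Localization.exists_leftFraction
    (FreeGroupoid.of (ForestCat k (MonoidHom.id Γ))) ⊤ f
  refine ⟨φ.Y', φ.f, φ.s, ?_⟩
  rw [hφ]
  exact φ.map_comp_map_s _ _

/-- The action of the universal groupoid. -/
noncomputable def groupoidAct {a b : ForestCat k (MonoidHom.id Γ)}
    (f : FreeGroupoid.mk a ⟶ FreeGroupoid.mk b) :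
    (Fin a.rank × UnitCell) × Γ ≃ (Fin b.rank × UnitCell) × Γ :=
  (FreeGroupoid.lift (cellFunctor k Γ)).map f

theorem groupoidAct_comp {a b c : ForestCat k (MonoidHom.id Γ)}
    (f : FreeGroupoid.mk a ⟶ FreeGroupoid.mk b) (g : FreeGroupoid.mk b ⟶ FreeGroupoid.mk c) :
    groupoidAct (f ≫ g) = (groupoidAct f).trans (groupoidAct g) :=
  (FreeGroupoid.lift (cellFunctor k Γ)).map_comp f g

theorem groupoidAct_homMk {a b : ForestCat k (MonoidHom.id Γ)} (u : a ⟶ b) :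
    groupoidAct (FreeGroupoid.homMk u) = Mor.act u :=
  FreeGroupoid.lift_map_homMk (cellFunctor k Γ) u

theorem groupoidAct_id (a : ForestCat k (MonoidHom.id Γ)) :
    groupoidAct (𝟙 (FreeGroupoid.mk a)) = Equiv.refl _ :=
  (FreeGroupoid.lift (cellFunctor k Γ)).map_id _

theorem groupoidAct_trans_act {a b c : ForestCat k (MonoidHom.id Γ)}
    {f : FreeGroupoid.mk a ⟶ FreeGroupoid.mk b} {u : a ⟶ c} {v : b ⟶ c}
    (h : f ≫ FreeGroupoid.homMk v = FreeGroupoid.homMk u) :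
    (groupoidAct f).trans (Mor.act v) = Mor.act u := by
  rw [← groupoidAct_homMk u, ← h, groupoidAct_comp, groupoidAct_homMk]

theorem eq_id_of_groupoidAct_eq_refl (hk : 2 ≤ k) {a : ForestCat k (MonoidHom.id Γ)}
    {f : FreeGroupoid.mk a ⟶ FreeGroupoid.mk a} (hf : groupoidAct f = Equiv.refl _) : f = 𝟙 _ := by
  obtain ⟨c, u, v, huv⟩ := exists_comp_homMk_eq hk f
  have h := groupoidAct_trans_act huv
  rw [hf, Equiv.refl_trans] at h
  have h2 : v = u := Mor.act_injective hk h
  rw [h2] at huv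
  rw [← cancel_mono (FreeGroupoid.homMk u), huv, Category.id_comp]

/-- The action of the automorphism group of an object of the universal groupoid. -/
noncomputable def autAct (a : ForestCat k (MonoidHom.id Γ)) :
    Aut (FreeGroupoid.mk a) →* Equiv.Perm ((Fin a.rank × UnitCell) × Γ) where
  toFun f := groupoidAct f.hom
  map_one' := groupoidAct_id a
  map_mul' f g := groupoidAct_comp g.hom f.hom

theorem autAct_injective (hk : 2 ≤ k) (a : ForestCat k (MonoidHom.id Γ)) :
    Function.Injective (autAct a) :=
  (injective_iff_map_eq_one _).2 fun _ hf => Aut.ext (eq_id_of_groupoidAct_eq_refl hk hf)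

/-- The elements of the image of the automorphism group are the fractions of actions of
morphisms. -/
theorem mem_range_autAct (hk : 2 ≤ k) {a : ForestCat k (MonoidHom.id Γ)}
    {σ : Equiv.Perm ((Fin a.rank × UnitCell) × Γ)} :
    σ ∈ (autAct a).range ↔ ∃ (M : ℕ+) (u v : Mor k Γ a.rank M), σ.trans v.act = u.act := by
  constructor
  · rintro ⟨f, rfl⟩
    obtain ⟨c, u, v, huv⟩ := exists_comp_homMk_eq hk f.hom
    exact ⟨c.rank, u, v, groupoidAct_trans_act huv⟩
  · rintro ⟨M, u, v, h⟩
    let c : ForestCat k (MonoidHom.id Γ) := ⟨M⟩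
    let u' : a ⟶ c := u
    let v' : a ⟶ c := v
    let f : FreeGroupoid.mk a ⟶ FreeGroupoid.mk a :=
      FreeGroupoid.homMk u' ≫ inv (FreeGroupoid.homMk v')
    refine ⟨(Groupoid.isoEquivHom _ _).symm f, ?_⟩
    have h1 := groupoidAct_trans_act (f := f) (u := u') (v := v') (by simp [f])
    exact Equiv.ext fun x => v.act.injective
      ((Equiv.congr_fun h1 x).trans (Equiv.congr_fun h x).symm)

end ForestCat

/-! ### The action of the wreath product -/

section wreath

variable {k r : ℕ} {Γ : Type*} [Group Γ]

/-- The action of a permutation of `[0, r)` in terms of unit cells. -/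
noncomputable def cellConj (r : ℕ) :
    Equiv.Perm (Set.Ico (0 : ℝ) r) ≃* Equiv.Perm (Fin r × UnitCell) :=
  (cellEquiv r).symm.permCongrHom

theorem cellConj_apply (v : Equiv.Perm (Set.Ico (0 : ℝ) r)) (x : Fin r × UnitCell) :
    cellConj r v x = (cellEquiv r).symm (v (cellEquiv r x)) := rfl

theorem cellVal_cellConj (v : Equiv.Perm (Set.Ico (0 : ℝ) r)) (x : Fin r × UnitCell) :
    cellVal (cellConj r v x) = v (cellEquiv r x) := by
  rw [cellConj_apply, cellVal_cellEquiv_symm]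

open Classical in
/-- Extension by `1` of a map on the `k`-adic rationals in `[0, r)`. -/
noncomputable def extendKadic (g : KadicIco k r → Γ) (x : Fin r × UnitCell) : Γ :=
  if h : IsKadic k (cellVal x) then g ⟨cellEquiv r x, h⟩ else 1

theorem extendKadic_apply (g : KadicIco k r → Γ) (y : KadicIco k r) :
    extendKadic g ((cellEquiv r).symm y.1) = g y := by
  have h : IsKadic k (cellVal ((cellEquiv r).symm y.1)) := by
    rw [cellVal_cellEquiv_symm]
    exact y.2
  rw [extendKadic, dif_pos h]
  congr 1
  exact Subtype.ext (Equiv.apply_symm_apply _ _)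

theorem extendKadic_injective :
    Function.Injective (extendKadic : (KadicIco k r → Γ) → Fin r × UnitCell → Γ) :=
  fun g h e => funext fun y => by rw [← extendKadic_apply g, e, extendKadic_apply]

theorem extendKadic_one : extendKadic (1 : KadicIco k r → Γ) = 1 := by
  funext x
  simp [extendKadic]

theorem extendKadic_mul (g h : KadicIco k r → Γ) (x : Fin r × UnitCell) :
    extendKadic (g * h) x = extendKadic g x * extendKadic h x := by
  by_cases hx : IsKadic k (cellVal x) <;> simp [extendKadic, hx]

/-- Both `v` and `v⁻¹` preserve the `k`-adic rationals, so the points where the default value `1` is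
used are also preserved. -/
theorem extendKadic_comp (v : HigmanThompson k r) (g : KadicIco k r → Γ) (x : Fin r × UnitCell) :
    extendKadic g (cellConj r v x) = extendKadic (fun y => g (v • y)) x := by
  by_cases hx : IsKadic k (cellVal x)
  · have hv := extendKadic_apply g (v • ⟨cellEquiv r x, hx⟩)
    rw [cellConj_apply]
    refine hv.trans ?_
    rw [extendKadic, dif_pos hx]
  · have hv : ¬ IsKadic k (cellVal (cellConj r v x)) := by
      intro hv
      rw [cellVal_cellConj] at hv
      have := IsKadicPL.map_isKadic (v⁻¹).2 hv
      rw [InvMemClass.coe_inv, Equiv.Perm.coe_inv, Equiv.symm_apply_apply] at this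
      exact hx this
    rw [extendKadic, extendKadic, dif_neg hx, dif_neg hv]

theorem extendKadic_bernoulliShift (v : HigmanThompson k r) (g : FinSuppMaps (KadicIco k r) Γ)
    (x : Fin r × UnitCell) :
    extendKadic (bernoulliShift (HigmanThompson k r) (KadicIco k r) Γ v g).1 x =
      extendKadic g.1 ((cellConj r v).symm x) := by
  have := extendKadic_comp v⁻¹ g.1 x
  rw [InvMemClass.coe_inv, map_inv] at this
  exact this.symm

/-- The action of the wreath product on `[0, r) × Γ`. -/
noncomputable def wreathAct (k r : ℕ) (Γ : Type*) [Group Γ] :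
    WreathProd (HigmanThompson k r) (KadicIco k r) Γ →*
      Equiv.Perm ((Fin r × UnitCell) × Γ) where
  toFun w := twist (cellConj r w.right) (extendKadic w.left.1)
  map_one' := by
    change twist (cellConj r 1) (extendKadic 1) = 1
    rw [extendKadic_one, map_one]
    ext x <;> simp [twist_apply]
  map_mul' w w' := by
    change twist (cellConj r (w.right.1 * w'.right.1)) (extendKadic (w.left.1 *
      (bernoulliShift (HigmanThompson k r) (KadicIco k r) Γ w.right w'.left).1)) =
        (twist (cellConj r w'.right) (extendKadic w'.left.1)).trans
          (twist (cellConj r w.right) (extendKadic w.left.1))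
    rw [twist_trans, map_mul]
    congr 1
    funext x
    rw [extendKadic_mul, extendKadic_bernoulliShift]

theorem wreathAct_injective : Function.Injective (wreathAct k r Γ) := by
  intro w w' h
  obtain ⟨h1, h2⟩ := twist_inj.1 h
  exact SemidirectProduct.ext (Subtype.ext (extendKadic_injective h2))
    (Subtype.ext ((cellConj r).injective h1))

end wreath

/-! ### Comparison of the two actions -/

/-- In this form, finitely many `k`-adic numbers acquire a common denominator `k^N`. -/
theorem IsKadic.eventually {k : ℕ} {x : ℝ} (hx : IsKadic k x) :
    ∀ᶠ N : ℕ in Filter.atTop, ∃ a : ℤ, (k : ℝ) ^ N * x = a := by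
  obtain ⟨n, a, ha⟩ := hx
  filter_upwards [Filter.eventually_ge_atTop n] with N hN
  refine ⟨k ^ (N - n) * a, ?_⟩
  push_cast
  rw [← ha, ← mul_assoc, ← pow_add, Nat.sub_add_cancel hN]

section range

variable {k r : ℕ} [NeZero k] {Γ : Type*} [Group Γ] {M : ℕ}

/-- Multiplication by a large power of `k`, preceded by an element of the Higman-Thompson group,
is the action of a forest. -/
theorem IsKadicPL.eventually_exists_forest {v : Equiv.Perm (Set.Ico (0 : ℝ) r)}
    (hv : IsKadicPL k r v) : ∀ᶠ N : ℕ in Filter.atTop, ∀ (M : ℕ)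
      (e : Fin r × UnitCell ≃ Fin M × UnitCell), (∀ x, cellVal (e x) = k ^ N * cellVal x) →
        ∃ q : SymForest k r M, q.cellPerm = (cellConj r v).symm.trans e := by
  obtain ⟨P, hfin, hP, hcov⟩ := hv
  choose! hI j b hb hj using hP
  have h1 := (Filter.eventually_all_finite hfin).2 fun p hp => (hI p hp).2.2.2.1.eventually
  have h2 := (Filter.eventually_all_finite hfin).2 fun p hp => (hI p hp).2.2.2.2.eventually
  have h3 := (Filter.eventually_all_finite hfin).2 fun p hp =>
    ((hb p hp).zpow_mul (-j p)).eventually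
  have h4 := (Filter.eventually_all_finite hfin).2 fun p (_ : p ∈ P) =>
    Filter.eventually_ge_atTop (j p).toNat
  have hk : (0 : ℝ) < k := by exact_mod_cast NeZero.pos k
  filter_upwards [h1, h2, h3, h4] with N h1 h2 h3 h4 M e he
  obtain ⟨D, hD⟩ := (hfin.image fun p => (N - j p).toNat).bddAbove
  refine IsPiecewiseStandard.exists_forest (D := D) fun y => ?_
  obtain ⟨x, rfl⟩ := (cellConj r v).surjective y
  obtain ⟨p, hp, hx1, hx2⟩ := hcov (cellEquiv r x)
  obtain ⟨A, hA⟩ := h1 p hp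
  obtain ⟨B, hB⟩ := h2 p hp
  obtain ⟨C, hC⟩ := h3 p hp
  have hpow : (k : ℝ) ^ (N - j p).toNat = k ^ N * (k : ℝ) ^ (-j p) := by
    have := h4 p hp
    rw [← zpow_natCast, ← zpow_natCast, ← zpow_add₀ hk.ne']
    congr 1
    omega
  have hinv : (k : ℝ) ^ (-j p) * (k : ℝ) ^ j p = 1 := by
    rw [← zpow_add₀ hk.ne', neg_add_cancel, zpow_zero]
  -- On a piece with slope `k^j`, depth `N - j` in the target matches depth `N` in the source, up to
  -- the integer shift `C`.
  have key : ∀ X : ℝ, (k : ℝ) ^ (N - j p).toNat * ((k : ℝ) ^ j p * X + b p) = k ^ N * X + C := by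
    intro X
    rw [hpow, ← hC]
    linear_combination (k : ℝ) ^ N * X * hinv
  rw [coe_cellEquiv] at hx1 hx2
  have hex : (k : ℝ) ^ N * cellVal x = (((e x).1 : ℕ) : ℤ) + (e x).2 := by
    rw [← he]
    simp [cellVal]
  have hkN : (0 : ℝ) < k ^ N := by positivity
  have hw := (e x).2.2
  -- After scaling, the end points of the piece are the integers `A` and `B`. The whole unit cell of
  -- `e x` thus lies inside the piece, where one affine formula holds.
  have hA' : A ≤ ((e x).1 : ℕ) := by
    have : (A : ℝ) < (((e x).1 : ℕ) : ℤ) + 1 := by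
      linarith [mul_le_mul_of_nonneg_left hx1 hkN.le, hw.2]
    exact Int.lt_add_one_iff.1 (by exact_mod_cast this)
  have hB' : (((e x).1 : ℕ) : ℤ) < B := by
    have : ((((e x).1 : ℕ) : ℤ) : ℝ) < B := by
      linarith [mul_lt_mul_of_pos_left hx2 hkN, hw.1]
    exact_mod_cast this
  refine ⟨_, hD ⟨p, hp, rfl⟩, ((e x).1 : ℕ) + C, (e x).1, ⟨(e x).2, ?_⟩, fun y' w' hy' => ?_⟩
  · rw [cellVal_cellConj, hj p hp _ hx1 hx2, key, coe_cellEquiv, hex]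
    push_cast
    ring
  · obtain ⟨X, hX⟩ : ∃ X : ℝ, (k : ℝ) ^ N * X = (((e x).1 : ℕ) : ℤ) + w' :=
      ⟨((((e x).1 : ℕ) : ℤ) + w') / k ^ N, by field_simp⟩
    have hw' := w'.2
    have hX1 : p.1 ≤ X := by
      refine le_of_mul_le_mul_left ?_ hkN
      rw [hA, hX]
      have : (A : ℝ) ≤ (((e x).1 : ℕ) : ℤ) := by exact_mod_cast hA'
      linarith [hw'.1]
    have hX2 : X < p.2 := by
      refine lt_of_mul_lt_mul_left ?_ hkN.le
      rw [hB, hX]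
      have : ((((e x).1 : ℕ) : ℤ) : ℝ) + 1 ≤ B := by exact_mod_cast hB'
      linarith [hw'.2]
    obtain ⟨x', hx'⟩ := exists_cellVal_eq ((hI p hp).1.trans hX1) (hX2.trans_le (hI p hp).2.2.1)
    have hy : y' = cellConj r v x' := by
      apply cellVal_injective
      rw [cellVal_cellConj, hj p hp _ (by rwa [coe_cellEquiv, hx']) (by rwa [coe_cellEquiv, hx']),
        coe_cellEquiv, hx']
      refine mul_left_cancel₀ (pow_pos hk (N - j p).toNat).ne' ?_
      rw [key, hy', hX]
      push_cast
      ring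
    subst hy
    rw [Equiv.trans_apply, Equiv.symm_apply_apply]
    have := eq_of_cellVal_eq (x := e x') (a := ((e x).1 : ℕ)) (w := w') (by rw [he, hx', hX])
    exact Prod.ext (Fin.ext (by exact_mod_cast this.1)) this.2

/-- A bijection which is the quotient of the actions of two forests lies in the Higman-Thompson
group. -/
theorem SymForest.isKadicPL_of_trans_cellPerm {p q : SymForest k r M}
    {v : Equiv.Perm (Set.Ico (0 : ℝ) r)}
    (h : (cellConj r v).trans q.cellPerm = p.cellPerm) : IsKadicPL k r v := by
  have hk : (0 : ℝ) < k := by exact_mod_cast NeZero.pos k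
  choose d a hda using p.exists_affine
  choose d' a' hda' using q.exists_affine
  -- The pieces are the leaf intervals of `p`. There `p` is `x ↦ k^d x - a` into the cell and `q⁻¹`
  -- is `w ↦ (w + a') / k^d'`, which gives the slope `k^(d - d')` and the constant term `(a' - a) /
  -- k^d'`.
  refine ⟨Set.range fun j => ((a j : ℝ) / k ^ d j, ((a j : ℝ) + 1) / k ^ d j),
    Set.finite_range _, ?_, fun x => ?_⟩
  · rintro _ ⟨j, rfl⟩
    have hd : (0 : ℝ) < k ^ d j := by positivity
    have hd' : (0 : ℝ) < k ^ d' j := by positivity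
    have h0 : cellVal (p.cellPerm.symm (j, 0)) = (a j : ℝ) / k ^ d j := by
      rw [eq_div_iff hd.ne', mul_comm, hda]
      simp
    refine ⟨⟨by simpa only [← h0] using cellVal_nonneg _,
      div_lt_div_of_pos_right (lt_add_one _) hd, ?_, ⟨d j, a j, by field_simp⟩,
      ⟨d j, a j + 1, by push_cast; field_simp⟩⟩, (d j : ℤ) - d' j,
      ((a' j : ℝ) - a j) / k ^ d' j, ⟨d' j, a' j - a j, by push_cast; field_simp⟩, ?_⟩
    · have := cellVal_lt (p.cellPerm.symm (j, 0))
      rw [h0, div_lt_iff₀ hd] at this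
      -- Among integers the strict inequality gives `a + 1 ≤ r * k^d`, so the right end point of the
      -- interval is at most `r`.
      have h1 : a j < r * k ^ d j := by exact_mod_cast this
      rw [div_le_iff₀ hd]
      exact_mod_cast h1
    · intro x hx1 hx2
      simp only at hx1 hx2
      rw [div_le_iff₀ hd] at hx1
      rw [lt_div_iff₀ hd] at hx2
      let w : UnitCell := ⟨k ^ d j * x - a j, by linarith, by linarith⟩
      have hx : p.cellPerm.symm (j, w) = (cellEquiv r).symm x := by
        apply cellVal_injective
        rw [cellVal_cellEquiv_symm]
        refine mul_left_cancel₀ hd.ne' ?_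
        rw [hda]
        simp [w]
      have hv : q.cellPerm.symm (j, w) = (cellEquiv r).symm (v x) := by
        rw [Equiv.symm_apply_eq]
        rw [Equiv.symm_apply_eq, ← h, Equiv.trans_apply, cellConj_apply,
          Equiv.apply_symm_apply] at hx
        exact hx
      have := hda' j w
      rw [hv, cellVal_cellEquiv_symm] at this
      rw [zpow_sub₀ hk.ne', zpow_natCast, zpow_natCast]
      field_simp
      rw [mul_comm, this]
      simp only [w]
      ring
  · have hx := hda (p.cellPerm ((cellEquiv r).symm x)).1 (p.cellPerm ((cellEquiv r).symm x)).2
    have hd : (0 : ℝ) < k ^ d (p.cellPerm ((cellEquiv r).symm x)).1 := by positivity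
    have hw := (p.cellPerm ((cellEquiv r).symm x)).2.2
    rw [Prod.mk.eta, Equiv.symm_apply_apply, cellVal_cellEquiv_symm] at hx
    refine ⟨_, ⟨(p.cellPerm ((cellEquiv r).symm x)).1, rfl⟩, ?_, ?_⟩
    · rw [div_le_iff₀ hd]
      linarith [hw.1]
    · rw [lt_div_iff₀ hd]
      linarith [hw.2]

theorem SymForest.isKadic_corner (q : SymForest k r M) (j : Fin M) :
    IsKadic k (cellVal (q.cellPerm.symm (j, 0))) := by
  obtain ⟨d, a, h⟩ := q.exists_affine j
  exact ⟨d, a, by rw [h]; simp⟩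

theorem mem_range_wreathAct_of_trans_act {σ : Equiv.Perm ((Fin r × UnitCell) × Γ)}
    {u v : ForestCat.Mor k Γ r M} (h : σ.trans v.act = u.act) : σ ∈ (wreathAct k r Γ).range := by
  let φ := u.forest.cellPerm.trans v.forest.cellPerm.symm
  let f : Fin r × UnitCell → Γ := fun x => (cornerFun v.label (v.forest.cellPerm x))⁻¹ *
    cornerFun u.label (v.forest.cellPerm x)
  have hσ : σ = twist φ f := by
    have : σ = u.act.trans v.act.symm := by
      rw [← h, Equiv.trans_assoc, Equiv.self_trans_symm, Equiv.trans_refl]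
    rw [this, ForestCat.Mor.act, ForestCat.Mor.act, twist_symm, twist_trans]
    rfl
  obtain ⟨t, ht⟩ := (cellConj r).surjective φ
  have htk : IsKadicPL k r t := SymForest.isKadicPL_of_trans_cellPerm (p := u.forest)
    (q := v.forest) (by
      rw [ht, Equiv.trans_assoc, Equiv.symm_trans_self, Equiv.trans_refl])
  -- Both labels are read off in the cells of `v`, so `f` is nontrivial only at left end points of
  -- leaf intervals of `v.forest`: finitely many points, all `k`-adic.
  have hf : ∀ x, f x ≠ 1 → ∃ j, v.forest.cellPerm.symm (j, 0) = x := by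
    intro x hx
    refine ⟨(v.forest.cellPerm x).1, ?_⟩
    rw [Equiv.symm_apply_eq]
    by_contra hne
    refine hx ?_
    have : (v.forest.cellPerm x).2 ≠ 0 := fun h0 => hne (Prod.ext rfl h0.symm)
    simp [f, cornerFun, this]
  let g : FinSuppMaps (KadicIco k r) Γ := ⟨fun y => f ((cellEquiv r).symm y.1), by
    refine Set.Finite.subset (Set.finite_range fun j => (⟨cellEquiv r
      (v.forest.cellPerm.symm (j, 0)), v.forest.isKadic_corner j⟩ : KadicIco k r)) fun y hy => ?_
    obtain ⟨j, hj⟩ := hf _ hy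
    refine ⟨j, Subtype.ext ?_⟩
    simp [hj]⟩
  have hg : extendKadic g.1 = f := by
    funext x
    by_cases hx : IsKadic k (cellVal x)
    · rw [extendKadic, dif_pos hx]
      simp [g]
    · rw [extendKadic, dif_neg hx]
      by_contra hne
      obtain ⟨j, rfl⟩ := hf x (Ne.symm hne)
      exact hx (v.forest.isKadic_corner j)
  refine ⟨⟨g, t, htk⟩, ?_⟩
  change twist (cellConj r t) (extendKadic g.1) = σ
  rw [hσ, ht, hg]

theorem exists_wreathAct_trans_act (hr : 0 < r)
    (w : WreathProd (HigmanThompson k r) (KadicIco k r) Γ) :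
    ∃ (M : ℕ+) (u v : ForestCat.Mor k Γ r M), (wreathAct k r Γ w).trans v.act = u.act := by
  obtain ⟨g, t⟩ := w
  obtain ⟨N₀, hN₀⟩ := (SymForest.id k r).exists_comp_scale
  -- For `y` in the support of `g`, the number `k^N * (t⁻¹ y)` has to be an integer, so that `t⁻¹ y`
  -- is a left end point in the complete forest `p`.
  have hsupp := (Filter.eventually_all_finite g.2).2 fun y _ => (t⁻¹ • y).2.eventually
  obtain ⟨N, hN, hsupp, hforest⟩ := ((Filter.eventually_ge_atTop N₀).and
    (hsupp.and (IsKadicPL.eventually_exists_forest t.2))).exists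
  obtain ⟨p, hp⟩ := hN₀ N hN
  rw [SymForest.cellPerm_comp, SymForest.cellPerm_id, Equiv.refl_trans] at hp
  obtain ⟨q, hq⟩ := hforest _ _ hp
  let f : Fin r × UnitCell → Γ := extendKadic g.1
  -- Since `q` is `t⁻¹` followed by `p`, the forests satisfy `q ∘ t = p`. The denominator carries no
  -- labels; the numerator carries the values of `g` found at the images under `t` of the corners of
  -- `p`.
  refine ⟨⟨r * k ^ N, mul_pos hr (pow_pos (NeZero.pos k) N)⟩,
    ⟨p, fun j => f (cellConj r t (p.cellPerm.symm (j, 0)))⟩, ⟨q, 1⟩, ?_⟩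
  change (twist (cellConj r t) f).trans (twist q.cellPerm (cornerFun 1)) =
    twist p.cellPerm (cornerFun fun j => f (cellConj r t (p.cellPerm.symm (j, 0))))
  rw [twist_trans, twist_inj]
  refine ⟨by rw [hq, ← Equiv.trans_assoc, Equiv.self_trans_symm, Equiv.refl_trans],
    funext fun c => ?_⟩
  rw [cornerFun_one, Pi.one_apply, one_mul, hq]
  change f (cellConj r t (p.cellPerm.symm c)) = _
  obtain ⟨j, w⟩ := c
  by_cases hw : w = 0
  · subst hw
    rw [cornerFun_corner]
  · rw [cornerFun, if_neg hw]
    -- A nontrivial value away from a corner would lie over a support point whose preimage under `t`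
    -- becomes an integer after scaling, which forces `w = 0`.
    by_contra hne
    refine hw ?_
    by_cases hx : IsKadic k (cellVal (p.cellPerm.symm (j, w)))
    · have hf : f (cellConj r t (p.cellPerm.symm (j, w))) =
          g.1 (t • ⟨cellEquiv r (p.cellPerm.symm (j, w)), hx⟩) := by
        simp only [f]
        rw [extendKadic_comp, extendKadic, dif_pos hx]
      rw [hf] at hne
      obtain ⟨a, ha⟩ := hsupp _ hne
      rw [inv_smul_smul, coe_cellEquiv, ← hp, Equiv.apply_symm_apply] at ha
      exact (eq_of_cellVal_eq (a := a) (w := 0) (by simpa using ha)).2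
    · refine (hne ?_).elim
      simp only [f]
      rw [extendKadic_comp, extendKadic, dif_neg hx]

end range

theorem mainTheorem9 (k : ℕ) (hk : 2 ≤ k) (Γ : Type*) [Group Γ] (r : ℕ+) :
    Nonempty (Aut (universalGroupoidObj k (MonoidHom.id Γ) r) ≃*
      WreathProd (HigmanThompson k r) (KadicIco k r) Γ) := by
  have : NeZero k := ⟨by omega⟩
  let a : ForestCat k (MonoidHom.id Γ) := ⟨r⟩
  have h : (ForestCat.autAct a).range = (wreathAct k r Γ).range := by
    ext σ
    rw [ForestCat.mem_range_autAct hk]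
    constructor
    · rintro ⟨M, u, v, h⟩
      exact mem_range_wreathAct_of_trans_act h
    · rintro ⟨w, rfl⟩
      exact exists_wreathAct_trans_act r.pos w
  exact ⟨(MonoidHom.ofInjective (ForestCat.autAct_injective hk a)).trans
    ((MulEquiv.subgroupCongr h).trans (MonoidHom.ofInjective wreathAct_injective).symm)⟩
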